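/- Let $W$ (women) and $M$ (men) be disjoint sets with $|W|=|M|=n$, and let $\mu$ be a fixed perfect marriage, i.e. a bijection between $W$ and $M$. Alice holds a profile of full preference lists for $W$ over $M$ (a strict total ordering of $M$ for each woman) and Bob holds a profile of full preference lists for $M$ over $W$; both know $\mu$. A pair $(w,m)\in W\times M$ is blocking if each of $w$ and $m$ prefers the other over their spouse in $\mu$, and $\mu$ is stable if there is no blocking pair. Fix a probability $p$ with $\frac12<p\le 1$ (for instance $p=\frac23$). Consider public-coin randomized two-party communication protocols that, on every fixed input, correctly determine whether or not $\mu$ is stable with probability at least $p$; the cost of a protocol is the number of bits exchanged in the worst case over all inputs and all outcomes of the randomness, and the randomized communication complexity is the lowest cost of such a protocol. Then the randomized communication complexity of determining whether or not $\mu$ is stable is $\Omega(n^2)$, and this bound is tight: it is $\Theta(n^2)$. That is, there are constants $c,C>0$ and $n_0$, depending only on $p$, such that for all $n\ge n_0$ and all $W$, $M$, $\mu$ as above, it is at least $cn^2$ and at most $Cn^2$. -/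

import Mathlib

open scoped NNReal ENNReal

namespace StableMarriage

/-- A full preference list over `A`: a (strict) total ordering of `A`. -/
structure PrefList (A : Type*) where
  /-- `prefers a b` means that `a` precedes `b` on the list, i.e. `a` is preferred over `b`. -/
  prefers : A → A → Prop
  isStrictTotalOrder : IsStrictTotalOrder A prefers

/-- A profile of full preference lists for `P` over `A`: one full preference list over `A` for
each participant in `P`. -/
abbrev Profile (P A : Type*) := P → PrefList A

variable {W M : Type*}

/-- `(w, m)` is a blocking pair with respect to the perfect marriage `μ`: each of `w` and `m`
prefers the other over their spouse in `μ`. -/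
def IsBlockingPair (prefW : Profile W M) (prefM : Profile M W) (μ : W ≃ M) (w : W) (m : M) :
    Prop :=
  (prefW w).prefers m (μ w) ∧ (prefM m).prefers w (μ.symm m)

/-- A perfect marriage is stable if there are no blocking pairs. -/
def IsStable (prefW : Profile W M) (prefM : Profile M W) (μ : W ≃ M) : Prop :=
  ∀ w m, ¬ IsBlockingPair prefW prefM μ w m

open Classical in
/-- The two-party decision problem for the fixed marriage `μ`: from the women's preferences and
the men's preferences, decide whether `μ` is stable. -/
noncomputable def stabilityProblem (μ : W ≃ M) (prefW : Profile W M) (prefM : Profile M W) :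
    Bool :=
  decide (IsStable prefW prefM μ)

end StableMarriage

namespace Communication

/-- Deterministic two-party communication protocols (protocol trees). Alice holds an input in `X`,
Bob holds an input in `Y`. At each point either the protocol ends with an output in `Z`, or one of
the two parties, determined by the bits exchanged so far, sends the other a bit that depends on
its own input (and on the bits exchanged so far). -/
inductive Protocol (X Y Z : Type*) where
  | output (z : Z) : Protocol X Y Z
  | alice (send : X → Bool) (next : Bool → Protocol X Y Z) : Protocol X Y Z
  | bob (send : Y → Bool) (next : Bool → Protocol X Y Z) : Protocol X Y Z

variable {X Y Z : Type*}

namespace Protocol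

/-- The output of the protocol on the input `(x, y)`. -/
def run : Protocol X Y Z → X → Y → Z
  | output z, _, _ => z
  | alice send next, x, y => (next (send x)).run x y
  | bob send next, x, y => (next (send y)).run x y

/-- The number of bits exchanged on the input `(x, y)`. -/
def bits : Protocol X Y Z → X → Y → ℕ
  | output _, _, _ => 0
  | alice send next, x, y => (next (send x)).bits x y + 1
  | bob send next, x, y => (next (send y)).bits x y + 1

/-- The communication cost: the number of bits exchanged on the worst input. -/
noncomputable def cost (P : Protocol X Y Z) : ℕ∞ := ⨆ (x : X) (y : Y), (P.bits x y : ℕ∞)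

end Protocol

/-- A randomized (public-coin) protocol: a probability distribution over deterministic protocols.
Private coins of the two parties are the special case in which the common randomness is a pair of
independent parts, each of which is used by one party only. -/
abbrev RandomizedProtocol (X Y Z : Type*) := PMF (Protocol X Y Z)

namespace RandomizedProtocol

/-- The distribution of the output of a randomized protocol on the fixed input `(x, y)`. -/
noncomputable def outputDist (R : RandomizedProtocol X Y Z) (x : X) (y : Y) : PMF Z :=
  R.map fun P => P.run x y

/-- `R` computes `f` with success probability `p`: on every fixed input, the output is correct
with probability at least `p`. -/
def Computes (R : RandomizedProtocol X Y Z) (p : ℝ≥0) (f : X → Y → Z) : Prop :=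
  ∀ x y, (p : ℝ≥0∞) ≤ R.outputDist x y (f x y)

/-- The communication cost of a randomized protocol: the number of bits exchanged in the worst
case over all inputs and all outcomes of the randomness. -/
noncomputable def cost (R : RandomizedProtocol X Y Z) : ℕ∞ := ⨆ P ∈ R.support, Protocol.cost P

end RandomizedProtocol

/-- The randomized communication complexity of `f` with success probability `p`: the lowest cost
of a randomized protocol that computes `f` with success probability `p` (and `⊤` if there is no
such protocol of finite cost). -/
noncomputable def randomizedComplexity (p : ℝ≥0) (f : X → Y → Z) : ℕ∞ :=
  ⨅ (R : RandomizedProtocol X Y Z) (_ : R.Computes p f), R.cost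

end Communication

/-! Which partners each person prefers over the spouse can be prescribed freely, and a blocking pair
is a common element of the two resulting sets. So stability is set disjointness on the `n² - n`
pairs off `μ`, and the lower bound is the linear bound for disjointness (`card_mul_le_cost`).
Conversely, Alice can send her whole set in `n²` bits.

For disjointness, a uniform `d` decides for each coordinate which party has the bit `false`; the
other party's bit is uniform. Such pairs are disjoint; setting one random coordinate to `true` on
both sides makes them intersect. Given `d` the parties are independent, so masses of rectangles are
products. If bit `i` is nearly unbiased on both sides, a rectangle has about the same disjoint mass
as mass intersecting at `i`. The squared biases sum to at most `2 log (1 / mass)`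
(`mass_mul_sum_bias_sq_le`), so in no rectangle does the disjoint mass exceed the intersecting mass
by more than a small fraction plus an exponentially small error (`rectangle_inequality`). A `k`-bit
protocol cuts its inputs into at most `2 ^ k` rectangles, so a constant advantage forces `k` to be
linear. -/

namespace CubeRectangle

/-! ### Numerical inequalities -/

open Finset

/-- The inequality in normalized form: `b` and `c` are the biases of the two parties. -/
theorem bias_inequality {η b c : ℝ} (hη : 0 < η) (hη1 : η ≤ 1) (hb : |b| ≤ 1) (hc : |c| ≤ 1) :
    3 * (b + c) / 2 - b * c ≤
      η * (1 + (b + c) / 2) + 50 / η * (((1 + c) * b ^ 2 + (1 + b) * c ^ 2) / 2) := by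
  obtain ⟨hb0, hb1⟩ := abs_le.1 hb
  obtain ⟨hc0, hc1⟩ := abs_le.1 hc
  set K := 50 / η with hK
  have hKη : K * η = 50 := by rw [hK]; field_simp
  have hK50 : 50 ≤ K := by rw [hK, le_div_iff₀ hη]; linarith
  have hs : 0 ≤ η * (1 + (b + c) / 2) := mul_nonneg hη.le (by linarith)
  have h1 : 0 ≤ (1 + c) * b ^ 2 := mul_nonneg (by linarith) (sq_nonneg _)
  have h2 : 0 ≤ (1 + b) * c ^ 2 := mul_nonneg (by linarith) (sq_nonneg _)
  -- If both biases are below `-1/2`, the left side is nonpositive; if only one is, a square term of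
  -- at least `1/8` times `K ≥ 50` beats the crude bound `5/2`.
  have key : ∀ b c : ℝ, -1 ≤ b → b ≤ 1 → -1 ≤ c → c < -(1 / 2) → 0 ≤ (1 + c) * b ^ 2 →
      0 ≤ (1 + b) * c ^ 2 →
      3 * (b + c) / 2 - b * c ≤ K * (((1 + c) * b ^ 2 + (1 + b) * c ^ 2) / 2) := by
    intro b c hb0 hb1 hc0 hc h1 h2
    rcases le_or_gt b (-(1 / 2)) with h | h
    · have : 3 * (b + c) / 2 - b * c ≤ 0 := by nlinarith
      exact this.trans (by positivity)
    · have h3 : 1 / 8 ≤ (1 + b) * c ^ 2 := by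
        have : 1 / 4 ≤ c ^ 2 := by nlinarith
        nlinarith
      have h4 : 3 * (b + c) / 2 - b * c ≤ 5 / 2 := by nlinarith
      nlinarith
  rcases lt_or_ge c (-(1 / 2)) with hc2 | hc2
  · have := key b c hb0 hb1 hc0 hc2 h1 h2
    linarith
  rcases lt_or_ge b (-(1 / 2)) with hb2 | hb2
  · have := key c b hc0 hc1 hb0 hb2 h2 h1
    rw [add_comm ((1 + b) * c ^ 2)] at this
    linarith
  have hsq : (b ^ 2 + c ^ 2) / 2 ≤ (1 + c) * b ^ 2 + (1 + b) * c ^ 2 := by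
    nlinarith [sq_nonneg b, sq_nonneg c]
  -- AM-GM. Used for `b` and for `c`, it spends `η/2` in all, which `hη2` supplies.
  have hlin : ∀ t : ℝ, 3 * t / 2 ≤ η / 4 + K / 20 * t ^ 2 := by
    intro t
    have : η * (η / 4 + K / 20 * t ^ 2 - 3 * t / 2) = (η / 2 - 3 * t / 2) ^ 2 + t ^ 2 / 4 := by
      linear_combination t ^ 2 / 20 * hKη
    have h0 : 0 ≤ η * (η / 4 + K / 20 * t ^ 2 - 3 * t / 2) := by rw [this]; positivity
    linarith [nonneg_of_mul_nonneg_right h0 hη]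
  have hη2 : η / 2 ≤ η * (1 + (b + c) / 2) := by nlinarith
  have hbc : -(b * c) ≤ (b ^ 2 + c ^ 2) / 2 := by nlinarith [sq_nonneg (b + c)]
  have hKsq : K * ((b ^ 2 + c ^ 2) / 4) ≤ K * (((1 + c) * b ^ 2 + (1 + b) * c ^ 2) / 2) :=
    mul_le_mul_of_nonneg_left (by linarith) (by linarith)
  nlinarith [hlin b, hlin c, sq_nonneg b, sq_nonneg c]

/-- The indices are the values of one bit. The two products on the left are the disjoint masses when
Bob's, respectively Alice's, bit is forced to `false`. Writing each pair as mean times `1 ± bias`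
gives `bias_inequality`. -/
theorem slice_inequality {η a₀ a₁ b₀ b₁ : ℝ} (hη : 0 < η) (hη1 : η ≤ 1)
    (ha₀ : 0 ≤ a₀) (ha₁ : 0 ≤ a₁) (hb₀ : 0 ≤ b₀) (hb₁ : 0 ≤ b₁) :
    (1 - η) * ((a₀ + a₁) / 2 * b₀ + a₀ * ((b₀ + b₁) / 2)) - 2 * (a₁ * b₁) ≤
      50 / η * ((a₀ + a₁) / 2 * b₀ * (((a₀ - a₁) / 2) / ((a₀ + a₁) / 2)) ^ 2 +
        a₀ * ((b₀ + b₁) / 2) * (((b₀ - b₁) / 2) / ((b₀ + b₁) / 2)) ^ 2) := by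
  have hbias : ∀ s t : ℝ, 0 ≤ s → 0 ≤ t → ∃ m b : ℝ, 0 ≤ m ∧ |b| ≤ 1 ∧ s = m * (1 + b) ∧
      t = m * (1 - b) ∧ (s + t) / 2 = m ∧ ((s - t) / 2) / ((s + t) / 2) = b := by
    intro s t hs ht
    rcases (add_nonneg hs ht).eq_or_lt with h | h
    -- Here the quotient is `0 / 0 = 0`, so the bias is zero.
    · have hs0 : s = 0 := by linarith
      have ht0 : t = 0 := by linarith
      exact ⟨0, 0, by simp [hs0, ht0]⟩
    · refine ⟨(s + t) / 2, ((s - t) / 2) / ((s + t) / 2), by positivity, ?_, ?_, ?_, rfl, rfl⟩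
      · rw [abs_div, abs_of_pos (by positivity : 0 < (s + t) / 2),
          div_le_one (by positivity), abs_le]
        constructor <;> linarith
      · field_simp; ring
      · field_simp; ring
  obtain ⟨m, b, hm, hb, h1, h2, h3, h4⟩ := hbias a₀ a₁ ha₀ ha₁
  obtain ⟨l, c, hl, hc, h5, h6, h7, h8⟩ := hbias b₀ b₁ hb₀ hb₁
  rw [h4, h8, h3, h7, h1, h2, h5, h6]
  have := mul_le_mul_of_nonneg_left (bias_inequality hη hη1 hb hc) (mul_nonneg hm hl)
  linear_combination 2 * this

/-- Trades entropy for a term linear in the mass, which the disjoint mass can absorb, and an error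
that is exponentially small once `L` is linear in the number of bits. -/
theorem negMulLog_le {x : ℝ} (hx : 0 ≤ x) (L : ℝ) :
    Real.negMulLog x ≤ x * L + Real.exp (-L) := by
  rcases hx.eq_or_lt with rfl | hx
  · simp [Real.exp_nonneg]
  · have h := Real.add_one_le_exp (-L - Real.log x)
    rw [Real.exp_sub, Real.exp_log hx, le_div_iff₀ hx] at h
    rw [Real.negMulLog]
    linarith

/-! ### Masses, slices and biases on the cube -/

variable {I : Type*}

/-- The distribution of one bit: it is `false` if `s` holds, and uniform otherwise. -/
noncomputable def coordWeight (s u : Bool) : ℝ := if s then (if u then 0 else 1) else 1 / 2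

theorem coordWeight_nonneg (s u : Bool) : 0 ≤ coordWeight s u := by
  unfold coordWeight; split_ifs <;> norm_num

/-- Flipping bit `i`. -/
def flip [DecidableEq I] (i : I) : (I → Bool) ≃ (I → Bool) :=
  Function.Involutive.toPerm (fun d => Function.update d i (!d i)) fun d => by ext j; simp

theorem flip_apply_self [DecidableEq I] (i : I) (d : I → Bool) : flip i d i = !d i := by
  simp [flip, Function.Involutive.toPerm]

theorem flip_apply_ne [DecidableEq I] {i j : I} (h : j ≠ i) (d : I → Bool) : flip i d j = d j := by
  simp [flip, Function.Involutive.toPerm, h]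

variable [Fintype I]

/-- The product distribution on the cube with independent bits, those in `d` being `false` and the
others uniform. -/
noncomputable def cubeWeight (d x : I → Bool) : ℝ := ∏ i, coordWeight (d i) (x i)

noncomputable def mass (A : Finset (I → Bool)) (d : I → Bool) : ℝ := ∑ x ∈ A, cubeWeight d x

noncomputable def sign (u : Bool) : ℝ := if u then -1 else 1

/-- The bias of bit `i` on `A`, for a bit that is free in `d`. -/
noncomputable def bias (A : Finset (I → Bool)) (d : I → Bool) (i : I) : ℝ :=
  if d i then 0 else (∑ x ∈ A, cubeWeight d x * sign (x i)) / mass A d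

theorem cubeWeight_nonneg (d x : I → Bool) : 0 ≤ cubeWeight d x :=
  prod_nonneg fun _ _ => coordWeight_nonneg _ _

theorem mass_nonneg (A : Finset (I → Bool)) (d : I → Bool) : 0 ≤ mass A d :=
  sum_nonneg fun _ _ => cubeWeight_nonneg _ _

theorem bias_of_fixed {d : I → Bool} {i : I} (h : d i = true) (A : Finset (I → Bool)) :
    bias A d i = 0 := by simp [bias, h]

variable [DecidableEq I]

/-- The marginal of `cubeWeight` on the bits other than `i`. -/
noncomputable def cubeWeightErase (i : I) (d x : I → Bool) : ℝ :=
  ∏ j ∈ univ.erase i, coordWeight (d j) (x j)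

/-- The mass of `A` conditioned on the value `u` of bit `i`. -/
noncomputable def slice (A : Finset (I → Bool)) (i : I) (u : Bool) (d : I → Bool) : ℝ :=
  ∑ x ∈ A with x i = u, cubeWeightErase i d x

theorem cubeWeightErase_nonneg (i : I) (d x : I → Bool) : 0 ≤ cubeWeightErase i d x :=
  prod_nonneg fun _ _ => coordWeight_nonneg _ _

theorem slice_nonneg (A : Finset (I → Bool)) (i : I) (u : Bool) (d : I → Bool) :
    0 ≤ slice A i u d :=
  sum_nonneg fun _ _ => cubeWeightErase_nonneg _ _ _

theorem cubeWeight_eq (i : I) (d x : I → Bool) :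
    cubeWeight d x = coordWeight (d i) (x i) * cubeWeightErase i d x :=
  (mul_prod_erase univ (fun j => coordWeight (d j) (x j)) (mem_univ i)).symm

theorem sum_cubeWeight_mul (A : Finset (I → Bool)) (i : I) (d : I → Bool) (g : Bool → ℝ) :
    ∑ x ∈ A, cubeWeight d x * g (x i) =
      coordWeight (d i) false * g false * slice A i false d +
        coordWeight (d i) true * g true * slice A i true d := by
  simp only [slice, mul_sum, sum_filter, ← sum_add_distrib]
  refine sum_congr rfl fun x _ => ?_
  rw [cubeWeight_eq i]
  cases x i <;> simp <;> ring

theorem mass_eq (A : Finset (I → Bool)) (i : I) (d : I → Bool) :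
    mass A d = coordWeight (d i) false * slice A i false d +
      coordWeight (d i) true * slice A i true d := by
  simpa [mass] using sum_cubeWeight_mul A i d fun _ => 1

theorem mass_of_free {d : I → Bool} {i : I} (h : d i = false) (A : Finset (I → Bool)) :
    mass A d = (slice A i false d + slice A i true d) / 2 := by
  rw [mass_eq A i, h]; simp [coordWeight]; ring

theorem mass_of_fixed {d : I → Bool} {i : I} (h : d i = true) (A : Finset (I → Bool)) :
    mass A d = slice A i false d := by
  rw [mass_eq A i, h]; simp [coordWeight]

theorem bias_of_free {d : I → Bool} {i : I} (h : d i = false) (A : Finset (I → Bool)) :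
    bias A d i = ((slice A i false d - slice A i true d) / 2) /
      ((slice A i false d + slice A i true d) / 2) := by
  rw [bias, sum_cubeWeight_mul, mass_of_free h, h]
  simp [coordWeight, sign]; ring

/-- A slice ignores `d i`, so `d` and `flip i d` share their slices at `i`. -/
theorem slice_congr {d d' : I → Bool} {i : I} (h : ∀ j, j ≠ i → d j = d' j)
    (A : Finset (I → Bool)) (u : Bool) : slice A i u d = slice A i u d' :=
  sum_congr rfl fun _ _ => prod_congr rfl fun j hj => by rw [h j (ne_of_mem_erase hj)]

theorem sum_cube_prod (f : I → Bool → ℝ) :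
    ∑ x : I → Bool, ∏ i, f i (x i) = ∏ i, (f i true + f i false) := by
  rw [← Fintype.piFinset_univ, ← prod_univ_sum]
  simp

theorem mass_univ (d : I → Bool) : mass univ d = 1 := by
  simp only [mass, cubeWeight]
  rw [sum_cube_prod fun i => coordWeight (d i)]
  refine prod_eq_one fun i _ => ?_
  cases d i <;> norm_num [coordWeight]

theorem slice_univ (i : I) (u : Bool) (d : I → Bool) : slice univ i u d = 1 := by
  have h := sum_cube_prod fun (j : I) v =>
    if j = i then (if v = u then 1 else 0) else coordWeight (d j) v
  have h2 : ∀ x : I → Bool, (∏ j, if j = i then (if x j = u then (1 : ℝ) else 0)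
      else coordWeight (d j) (x j)) = if x i = u then cubeWeightErase i d x else 0 := by
    intro x
    rw [← mul_prod_erase univ _ (mem_univ i), cubeWeightErase,
      prod_congr rfl fun j hj => if_neg (ne_of_mem_erase hj)]
    simp
  rw [slice, sum_filter, ← sum_congr rfl fun x _ => h2 x, h]
  refine prod_eq_one fun j _ => ?_
  by_cases hj : j = i
  · cases u <;> simp [hj]
  · cases d j <;> norm_num [coordWeight, hj]

/-- The level-one inequality. -/
theorem mass_mul_sum_bias_sq_le (A : Finset (I → Bool)) (d : I → Bool) :
    mass A d * ∑ i, bias A d i ^ 2 ≤ 2 * Real.negMulLog (mass A d) := by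
  rcases (mass_nonneg A d).eq_or_lt with h0 | hpos
  · simp [← h0]
  set c := ∑ i, bias A d i ^ 2 with hc
  -- The exponential moment of `∑ bias * sign` is bounded from both sides; the mean of this sum on
  -- `A` is `c`.
  have hmean : ∑ x ∈ A, cubeWeight d x * ∑ i, bias A d i * sign (x i) = mass A d * c := by
    simp only [mul_sum, hc]
    rw [sum_comm]
    refine sum_congr rfl fun i _ => ?_
    have : ∀ x, cubeWeight d x * (bias A d i * sign (x i)) =
        bias A d i * (cubeWeight d x * sign (x i)) := fun x => by ring
    simp only [this, ← mul_sum]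
    cases hd : d i
    · have : ∑ x ∈ A, cubeWeight d x * sign (x i) = bias A d i * mass A d := by
        simp [bias, hd, hpos.ne']
      rw [this]; ring
    · simp [bias_of_fixed hd]
  -- Jensen on `A`: the exponential lies above its tangent at `c`.
  have hlower : mass A d * Real.exp c ≤
      ∑ x ∈ A, cubeWeight d x * Real.exp (∑ i, bias A d i * sign (x i)) := by
    have : ∑ x ∈ A, cubeWeight d x *
        (Real.exp c * (∑ i, bias A d i * sign (x i) - c + 1)) = mass A d * Real.exp c := by
      have h : ∀ x, cubeWeight d x * (Real.exp c * (∑ i, bias A d i * sign (x i) - c + 1)) =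
          Real.exp c * (cubeWeight d x * ∑ i, bias A d i * sign (x i)) +
            Real.exp c * (1 - c) * cubeWeight d x := fun x => by ring
      simp only [h, sum_add_distrib, ← mul_sum]
      rw [hmean, ← mass]; ring
    rw [← this]
    refine sum_le_sum fun x _ => mul_le_mul_of_nonneg_left ?_ (cubeWeight_nonneg d x)
    have h := mul_le_mul_of_nonneg_left
      (Real.add_one_le_exp (∑ i, bias A d i * sign (x i) - c)) (Real.exp_nonneg c)
    rwa [← Real.exp_add, add_sub_cancel] at h
  -- On the whole cube the bits are independent, and each free one contributes a `cosh` of its bias.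
  have hupper : ∑ x ∈ A, cubeWeight d x * Real.exp (∑ i, bias A d i * sign (x i)) ≤
      Real.exp (c / 2) := by
    refine (sum_le_sum_of_subset_of_nonneg (subset_univ A) fun _ _ _ =>
      mul_nonneg (cubeWeight_nonneg _ _) (Real.exp_nonneg _)).trans ?_
    simp only [cubeWeight, Real.exp_sum, ← prod_mul_distrib]
    rw [sum_cube_prod fun i v => coordWeight (d i) v * Real.exp (bias A d i * sign v), hc,
      sum_div, Real.exp_sum]
    refine prod_le_prod (fun i _ => ?_) fun i _ => ?_
    · have := coordWeight_nonneg (d i)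
      exact add_nonneg (mul_nonneg (this _) (Real.exp_nonneg _))
        (mul_nonneg (this _) (Real.exp_nonneg _))
    · cases hd : d i
      · refine le_trans (le_of_eq ?_) (Real.cosh_le_exp_half_sq _)
        simp [coordWeight, sign, Real.cosh_eq]; ring
      · simp [coordWeight, bias_of_fixed hd]
  have h := hlower.trans hupper
  have hlog := Real.log_le_log (by positivity) h
  rw [Real.log_mul hpos.ne' (Real.exp_ne_zero _), Real.log_exp, Real.log_exp] at hlog
  rw [Real.negMulLog]
  nlinarith

/-! ### Disjoint against intersecting mass of a rectangle -/

theorem sum_nonpos_of_flip (i : I) (f : (I → Bool) → ℝ)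
    (h : ∀ d, d i = false → f d + f (flip i d) ≤ 0) : ∑ d, f d ≤ 0 := by
  have h2 : ∑ d, f (flip i d) = ∑ d, f d := Equiv.sum_comp (flip i) f
  have h3 : ∑ d, (f d + f (flip i d)) ≤ 0 := by
    refine sum_nonpos fun d _ => ?_
    cases hd : d i
    · exact h d hd
    · have h4 := h (flip i d) (by simp [flip_apply_self, hd])
      have h5 : flip i (flip i d) = d := by
        ext j
        by_cases hj : j = i
        · subst hj; simp [flip_apply_self]
        · simp [flip_apply_ne hj]
      rw [h5] at h4
      linarith
  rw [sum_add_distrib, h2] at h3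
  linarith

/-- Pairing `d` with `flip i d` exchanges the party whose bit `i` is forced to `false`; the sum over
such a pair is `slice_inequality`. -/
theorem coordinate_inequality {η : ℝ} (hη : 0 < η) (hη1 : η ≤ 1) (A B : Finset (I → Bool))
    (i : I) :
    ∑ d : I → Bool, ((1 - η) * (mass A d * mass B (fun j => !d j)) -
      slice A i true d * slice B i true (fun j => !d j)) ≤
    ∑ d : I → Bool, 50 / η * (mass A d * mass B (fun j => !d j) *
      (bias A d i ^ 2 + bias B (fun j => !d j) i ^ 2)) := by
  rw [← sub_nonpos, ← sum_sub_distrib]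
  refine sum_nonpos_of_flip i _ fun d hd => ?_
  have hf : flip i d i = true := by simp [flip_apply_self, hd]
  have hc : ∀ j, j ≠ i → flip i d j = d j := fun j hj => flip_apply_ne hj d
  have hc' : ∀ j, j ≠ i → (!flip i d j) = !d j := fun j hj => by rw [hc j hj]
  have h1 : (fun j => !d j) i = true := by simp [hd]
  have h2 : (fun j => !flip i d j) i = false := by simp [hf]
  rw [mass_of_free hd, bias_of_free hd, mass_of_fixed (d := fun j => !d j) h1,
    bias_of_fixed (d := fun j => !d j) h1, mass_of_fixed hf,
    bias_of_fixed hf, mass_of_free (d := fun j => !flip i d j) h2,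
    bias_of_free (d := fun j => !flip i d j) h2]
  simp only [slice_congr hc, slice_congr (d := fun j => !flip i d j) hc']
  have := slice_inequality hη hη1 (slice_nonneg A i false d) (slice_nonneg A i true d)
    (slice_nonneg B i false fun j => !d j) (slice_nonneg B i true fun j => !d j)
  linear_combination this

/-- A rectangle that carries much of the disjoint pairs carries almost as much of the pairs that
intersect in one point. -/
theorem rectangle_inequality {η : ℝ} (hη : 0 < η) (hη1 : η ≤ 1) (L : ℝ)
    (A B : Finset (I → Bool)) :
    ∑ i : I, ∑ d : I → Bool, ((1 - η) * (mass A d * mass B (fun j => !d j)) -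
      slice A i true d * slice B i true (fun j => !d j)) ≤
    100 / η * ∑ d : I → Bool, (mass A d * mass B (fun j => !d j) * L + Real.exp (-L)) := by
  refine (sum_le_sum fun i _ => coordinate_inequality hη hη1 A B i).trans ?_
  rw [sum_comm, mul_sum]
  refine sum_le_sum fun d _ => ?_
  set B' := mass B fun j => !d j with hB'
  have ha := mass_nonneg A d
  have hb : 0 ≤ B' := mass_nonneg B _
  have h1 := mul_le_mul_of_nonneg_left (mass_mul_sum_bias_sq_le A d) hb
  have h2 := mul_le_mul_of_nonneg_left (mass_mul_sum_bias_sq_le B fun j => !d j) ha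
  -- The entropy of a product splits, so the level-one bounds of both parties combine into the
  -- entropy of the joint mass.
  have h3 := negMulLog_le (mul_nonneg ha hb) L
  rw [Real.negMulLog_mul] at h3
  rw [← mul_sum, ← mul_sum, sum_add_distrib]
  have h4 : mass A d * B' * (∑ i, bias A d i ^ 2 + ∑ i, bias B (fun j => !d j) i ^ 2) ≤
      2 * (mass A d * B' * L + Real.exp (-L)) := by
    rw [← hB'] at h2
    linarith
  have := mul_le_mul_of_nonneg_left h4 (by positivity : 0 ≤ 50 / η)
  refine this.trans (le_of_eq (by ring))

end CubeRectangle

/-! ### Protocols and rectangles -/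

namespace Communication

open Finset

namespace Protocol

variable {X Y Z : Type*}

theorem bits_le_cost (P : Protocol X Y Z) (x : X) (y : Y) : (P.bits x y : ℕ∞) ≤ P.cost :=
  le_iSup₂ (f := fun x y => (P.bits x y : ℕ∞)) x y

/-- If `w` has sum at most `ε` on every rectangle then it has sum at most `2 ^ k * ε` on the set of
inputs accepted by a protocol of cost `k`. The inputs are pulled back along `φ` and `ψ`. -/
theorem sum_accepted_le {X' Y' : Type*} (φ : X' → X) (ψ : Y' → Y)
    (w : X' → Y' → ℝ) {ε : ℝ} (hε : 0 ≤ ε)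
    (hw : ∀ (A : Finset X') (B : Finset Y'), ∑ x ∈ A, ∑ y ∈ B, w x y ≤ ε)
    (P : Protocol X Y Bool) (k : ℕ) (A : Finset X') (B : Finset Y')
    (hk : ∀ x ∈ A, ∀ y ∈ B, P.bits (φ x) (ψ y) ≤ k) :
    ∑ x ∈ A, ∑ y ∈ B, w x y * (if P.run (φ x) (ψ y) = true then 1 else 0) ≤ 2 ^ k * ε := by
  classical
  induction P generalizing k A B with
  | output z =>
    cases z
    · simp only [run, Bool.false_eq_true, if_false, mul_zero, sum_const_zero]
      positivity
    · simp only [run, if_true, mul_one]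
      exact (hw A B).trans (le_mul_of_one_le_left hε (one_le_pow₀ one_le_two))
  | alice send next ih =>
    cases k with
    | zero =>
      -- With no bits left, only an empty rectangle can reach a node that sends a bit.
      rcases A.eq_empty_or_nonempty with rfl | ⟨x, hx⟩
      · simpa using hε
      rcases B.eq_empty_or_nonempty with rfl | ⟨y, hy⟩
      · simpa using hε
      simpa [bits] using hk x hx y hy
    | succ k =>
      have hcase : ∀ b, ∑ x ∈ A with send (φ x) = b, ∑ y ∈ B,
          w x y * (if (alice send next).run (φ x) (ψ y) = true then 1 else 0) ≤ 2 ^ k * ε := by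
        intro b
        refine le_trans (le_of_eq ?_) (ih b k {x ∈ A | send (φ x) = b} B ?_)
        · refine sum_congr rfl fun x hx => ?_
          simp only [run, (mem_filter.1 hx).2]
        · intro x hx y hy
          have h := hk x (mem_filter.1 hx).1 y hy
          rw [bits, (mem_filter.1 hx).2] at h
          omega
      rw [← sum_filter_add_sum_filter_not A fun x => send (φ x) = true]
      simp only [Bool.not_eq_true]
      rw [pow_succ]
      linarith [hcase true, hcase false]
  | bob send next ih =>
    cases k with
    | zero =>
      rcases A.eq_empty_or_nonempty with rfl | ⟨x, hx⟩
      · simpa using hε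
      rcases B.eq_empty_or_nonempty with rfl | ⟨y, hy⟩
      · simpa using hε
      simpa [bits] using hk x hx y hy
    | succ k =>
      have hcase : ∀ b, ∑ y ∈ B with send (ψ y) = b, ∑ x ∈ A,
          w x y * (if (bob send next).run (φ x) (ψ y) = true then 1 else 0) ≤ 2 ^ k * ε := by
        intro b
        rw [sum_comm]
        refine le_trans (le_of_eq ?_) (ih b k A {y ∈ B | send (ψ y) = b} ?_)
        · refine sum_congr rfl fun x hx => sum_congr rfl fun y hy => ?_
          simp only [run, (mem_filter.1 hy).2]
        · intro x hx y hy
          have h := hk x hx y (mem_filter.1 hy).1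
          rw [bits, (mem_filter.1 hy).2] at h
          omega
      rw [sum_comm, ← sum_filter_add_sum_filter_not B fun y => send (ψ y) = true]
      simp only [Bool.not_eq_true]
      rw [pow_succ]
      linarith [hcase true, hcase false]

/-- Alice sends `k` bits that determine what Bob needs to know, and Bob replies with the output. -/
theorem exists_run_eq_bits_eq (k : ℕ) (g : X → Fin k → Bool) (h : (Fin k → Bool) → Y → Bool) :
    ∃ P : Protocol X Y Bool, ∀ x y, P.run x y = h (g x) y ∧ P.bits x y = k + 1 := by
  induction k with
  | zero =>
    refine ⟨bob (h Fin.elim0) output, fun x y => ⟨?_, rfl⟩⟩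
    rw [Subsingleton.elim (g x) Fin.elim0]
    rfl
  | succ k ih =>
    choose P hP using fun b => ih (fun x => Fin.tail (g x)) fun z => h (Fin.cons b z)
    refine ⟨alice (fun x => g x 0) P, fun x y => ⟨?_, ?_⟩⟩
    · rw [run, (hP _ x y).1, Fin.cons_self_tail]
    · rw [bits, (hP _ x y).2]

end Protocol

variable {X Y : Type*}

theorem RandomizedProtocol.cost_pure {Z : Type*} (P : Protocol X Y Z) :
    RandomizedProtocol.cost (PMF.pure P) = P.cost := by
  simp [RandomizedProtocol.cost, PMF.support_pure]

theorem randomizedComplexity_le {p : ℝ≥0} (hp : p ≤ 1) (k : ℕ) (g : X → Fin k → Bool)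
    (h : (Fin k → Bool) → Y → Bool) :
    randomizedComplexity p (fun x y => h (g x) y) ≤ k + 1 := by
  obtain ⟨P, hP⟩ := Protocol.exists_run_eq_bits_eq k g h
  refine (iInf₂_le (PMF.pure P) fun x y => ?_).trans ?_
  · rw [RandomizedProtocol.outputDist, PMF.pure_map, (hP x y).1]
    simpa using hp
  · rw [RandomizedProtocol.cost_pure]
    refine iSup₂_le fun x y => ?_
    rw [(hP x y).2]; push_cast; rfl

/-- The probability that `R` accepts. -/
noncomputable def acceptance (R : RandomizedProtocol X Y Bool) (x : X) (y : Y) : ℝ :=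
  (R.outputDist x y true).toReal

theorem hasSum_acceptance (R : RandomizedProtocol X Y Bool) (x : X) (y : Y) :
    HasSum (fun P : Protocol X Y Bool => (R P).toReal * (if P.run x y = true then 1 else 0))
      (acceptance R x y) := by
  have h : R.outputDist x y true = ∑' P, if true = P.run x y then R P else 0 := by
    rw [RandomizedProtocol.outputDist, PMF.map_apply]
    refine tsum_congr fun P => ?_
    congr
  have hne : ∑' P, (if true = P.run x y then R P else 0) ≠ ⊤ := h ▸ PMF.apply_ne_top _ _
  rw [acceptance, h]
  convert ENNReal.hasSum_toReal hne using 2 with P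
  · by_cases hP : P.run x y = true <;> simp [hP]
  · rw [ENNReal.tsum_toReal_eq]
    exact ENNReal.ne_top_of_tsum_ne_top hne

theorem le_acceptance {R : RandomizedProtocol X Y Bool} {p : ℝ≥0} {f : X → Y → Bool}
    (hR : R.Computes p f) {x : X} {y : Y} (h : f x y = true) : (p : ℝ) ≤ acceptance R x y := by
  have := hR x y
  rw [h] at this
  exact ENNReal.toReal_mono (PMF.apply_ne_top _ _) this

theorem acceptance_le {R : RandomizedProtocol X Y Bool} {p : ℝ≥0} {f : X → Y → Bool}
    (hR : R.Computes p f) {x : X} {y : Y} (h : f x y = false) :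
    acceptance R x y ≤ 1 - (p : ℝ) := by
  have h1 := hR x y
  rw [h] at h1
  have h2 := ENNReal.toReal_mono (PMF.apply_ne_top _ _) h1
  have h3 := (R.outputDist x y).tsum_coe
  rw [tsum_fintype, Fintype.sum_bool] at h3
  have h4 := congrArg ENNReal.toReal h3
  rw [ENNReal.toReal_add (PMF.apply_ne_top _ _) (PMF.apply_ne_top _ _)] at h4
  simp only [ENNReal.coe_toReal, ENNReal.toReal_one] at h2 h4
  rw [acceptance]
  linarith

/-- Averages `Protocol.sum_accepted_le` over the coins; each protocol in the support costs at most
`k`. -/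
theorem sum_acceptance_le {X' Y' : Type*} [Fintype X'] [Fintype Y'] (φ : X' → X) (ψ : Y' → Y)
    (w : X' → Y' → ℝ) {ε : ℝ} (hε : 0 ≤ ε)
    (hw : ∀ (A : Finset X') (B : Finset Y'), ∑ x ∈ A, ∑ y ∈ B, w x y ≤ ε)
    (R : RandomizedProtocol X Y Bool) (k : ℕ) (hk : R.cost ≤ k) :
    ∑ x, ∑ y, w x y * acceptance R (φ x) (ψ y) ≤ 2 ^ k * ε := by
  have h1 : HasSum (fun P : Protocol X Y Bool => (R P).toReal *
      ∑ x, ∑ y, w x y * (if P.run (φ x) (ψ y) = true then 1 else 0))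
      (∑ x, ∑ y, w x y * acceptance R (φ x) (ψ y)) := by
    simp only [mul_sum]
    refine hasSum_sum fun x _ => hasSum_sum fun y _ => ?_
    simpa only [mul_left_comm] using (hasSum_acceptance R (φ x) (ψ y)).mul_left (w x y)
  have h2 : HasSum (fun P => (R P).toReal * (2 ^ k * ε)) (1 * (2 ^ k * ε)) := by
    refine HasSum.mul_right _ ?_
    have h := ENNReal.hasSum_toReal (f := R) R.tsum_coe_ne_top
    rwa [← ENNReal.tsum_toReal_eq fun P => R.apply_ne_top P, R.tsum_coe, ENNReal.toReal_one] at h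
  rw [← one_mul (2 ^ k * ε)]
  refine hasSum_le (fun P => ?_) h1 h2
  by_cases hP : P ∈ R.support
  · refine mul_le_mul_of_nonneg_left ?_ ENNReal.toReal_nonneg
    refine Protocol.sum_accepted_le φ ψ w hε hw P k univ univ fun x _ y _ => ?_
    have h : P.cost ≤ R.cost := le_iSup₂ (f := fun P (_ : P ∈ R.support) => Protocol.cost P) P hP
    exact_mod_cast (P.bits_le_cost _ _).trans (h.trans hk)
  · rw [PMF.mem_support_iff, not_not] at hP
    simp [hP]

end Communication

/-! ### The signed weight against rectangles and protocols -/

namespace CubeRectangle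

open Finset

variable {I : Type*} [Fintype I] [DecidableEq I]

/-- The signed weight that compares the uniform mixture of disjoint pairs with the uniform mixture
of pairs that intersect at one point. -/
noncomputable def signedWeight (θ : ℝ) (x y : I → Bool) : ℝ :=
  ∑ i : I, ∑ d : I → Bool, ((1 - θ) * (cubeWeight d x * cubeWeight (fun j => !d j) y) -
    (if x i = true then cubeWeightErase i d x else 0) *
      (if y i = true then cubeWeightErase i (fun j => !d j) y else 0))

theorem sum_signedWeight (θ : ℝ) (A B : Finset (I → Bool)) :
    ∑ x ∈ A, ∑ y ∈ B, signedWeight θ x y =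
      ∑ i : I, ∑ d : I → Bool, ((1 - θ) * (mass A d * mass B (fun j => !d j)) -
        slice A i true d * slice B i true (fun j => !d j)) := by
  have h : ∀ (i : I) (d : I → Bool), (1 - θ) * (mass A d * mass B (fun j => !d j)) -
        slice A i true d * slice B i true (fun j => !d j) =
      ∑ x ∈ A, ∑ y ∈ B, ((1 - θ) * (cubeWeight d x * cubeWeight (fun j => !d j) y) -
        (if x i = true then cubeWeightErase i d x else 0) *
          (if y i = true then cubeWeightErase i (fun j => !d j) y else 0)) := by
    intro i d
    rw [slice, slice, mass, mass, sum_filter, sum_filter, sum_mul_sum, sum_mul_sum, mul_sum,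
      ← sum_sub_distrib]
    refine sum_congr rfl fun x _ => ?_
    rw [mul_sum, ← sum_sub_distrib]
  have h2 : ∀ x ∈ A, ∑ y ∈ B, signedWeight θ x y = ∑ i : I, ∑ d : I → Bool, ∑ y ∈ B,
      ((1 - θ) * (cubeWeight d x * cubeWeight (fun j => !d j) y) -
        (if x i = true then cubeWeightErase i d x else 0) *
          (if y i = true then cubeWeightErase i (fun j => !d j) y else 0)) := by
    intro x _
    simp only [signedWeight]
    rw [sum_comm]
    exact sum_congr rfl fun i _ => sum_comm
  rw [sum_congr rfl h2, sum_comm]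
  refine sum_congr rfl fun i _ => ?_
  rw [sum_comm]
  exact sum_congr rfl fun d _ => (h i d).symm

/-- Take `L = δ * card I` in `rectangle_inequality`. The sum over `i` counts the disjoint mass `card
I` times, so the linear term is absorbed by raising `η` by `100 / η * δ`. -/
theorem sum_signedWeight_le {η δ : ℝ} (hη : 0 < η) (hη1 : η ≤ 1) (A B : Finset (I → Bool)) :
    ∑ x ∈ A, ∑ y ∈ B, signedWeight (η + 100 / η * δ) x y ≤
      2 ^ Fintype.card I * (100 / η * Real.exp (-(δ * Fintype.card I))) := by
  rw [sum_signedWeight]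
  have h := rectangle_inequality hη hη1 (δ * Fintype.card I) A B
  simp only [sum_add_distrib, sum_sub_distrib, ← mul_sum, ← sum_mul, sum_const, card_univ,
    nsmul_eq_mul, Fintype.card_fun, Fintype.card_bool, Nat.cast_pow, Nat.cast_ofNat] at h ⊢
  linear_combination h

/-- One of the two parties has bit `i` forced to `false`. -/
theorem cubeWeight_mul_eq_zero {d x y : I → Bool} {i : I} (hx : x i = true) (hy : y i = true) :
    cubeWeight d x * cubeWeight (fun j => !d j) y = 0 := by
  rw [cubeWeight_eq i, cubeWeight_eq i, hx, hy]
  cases h : d i <;> simp [coordWeight]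

/-- The mass of the signed weight against a function that is at least `p` on disjoint pairs and at
most `1 - p` on intersecting pairs. -/
theorem le_sum_signedWeight_mul {θ p : ℝ} (hθ : θ ≤ 1) (q : (I → Bool) → (I → Bool) → ℝ)
    (hq : ∀ x y, (∀ i, ¬(x i = true ∧ y i = true)) → p ≤ q x y)
    (hq' : ∀ x y i, x i = true → y i = true → q x y ≤ 1 - p) :
    2 ^ Fintype.card I * (Fintype.card I * ((1 - θ) * p - (1 - p))) ≤
      ∑ x, ∑ y, signedWeight θ x y * q x y := by
  have hpt : ∀ x y, ∑ i : I, ∑ d : I → Bool,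
      ((1 - θ) * p * (cubeWeight d x * cubeWeight (fun j => !d j) y) -
        (1 - p) * ((if x i = true then cubeWeightErase i d x else 0) *
          (if y i = true then cubeWeightErase i (fun j => !d j) y else 0))) ≤
      signedWeight θ x y * q x y := by
    intro x y
    simp only [signedWeight, sum_mul]
    refine sum_le_sum fun i _ => sum_le_sum fun d _ => ?_
    rw [sub_mul (_ * (_ * _))]
    refine sub_le_sub (α := ℝ) ?_ ?_
    · rw [mul_right_comm]
      -- Intersecting pairs have no disjoint weight, so `p ≤ q` is needed on disjoint pairs only.
      by_cases h : ∃ i, x i = true ∧ y i = true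
      · obtain ⟨i, hx, hy⟩ := h
        rw [cubeWeight_mul_eq_zero hx hy]; simp
      · exact mul_le_mul_of_nonneg_left (hq x y (not_exists.1 h)) (mul_nonneg (by linarith)
          (mul_nonneg (cubeWeight_nonneg _ _) (cubeWeight_nonneg _ _)))
    · rw [mul_comm (1 - p)]
      by_cases hx : x i = true
      · by_cases hy : y i = true
        · refine mul_le_mul_of_nonneg_left (hq' x y i hx hy) ?_
          simp only [hx, hy, if_true]
          exact mul_nonneg (cubeWeightErase_nonneg _ _ _) (cubeWeightErase_nonneg _ _ _)
        · simp [hy]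
      · simp [hx]
  refine le_trans (le_of_eq ?_) (sum_le_sum fun x _ => sum_le_sum fun y _ => hpt x y)
  have h2 : ∀ x : I → Bool, ∑ y : I → Bool, ∑ i : I, ∑ d : I → Bool,
      ((1 - θ) * p * (cubeWeight d x * cubeWeight (fun j => !d j) y) -
        (1 - p) * ((if x i = true then cubeWeightErase i d x else 0) *
          (if y i = true then cubeWeightErase i (fun j => !d j) y else 0))) =
      ∑ i : I, ∑ d : I → Bool, ((1 - θ) * p * cubeWeight d x -
        (1 - p) * (if x i = true then cubeWeightErase i d x else 0)) := by
    intro x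
    rw [sum_comm]
    refine sum_congr rfl fun i _ => ?_
    rw [sum_comm]
    refine sum_congr rfl fun d _ => ?_
    have h1 := mass_univ fun j => !d j
    have h2 := slice_univ i true fun j => !d j
    rw [mass] at h1
    rw [slice, sum_filter] at h2
    rw [sum_sub_distrib, ← mul_sum, ← mul_sum, ← mul_sum, ← mul_sum, h1, h2, mul_one, mul_one]
  have h3 : ∀ (i : I) (d : I → Bool), ∑ x : I → Bool, ((1 - θ) * p * cubeWeight d x -
      (1 - p) * (if x i = true then cubeWeightErase i d x else 0)) = (1 - θ) * p - (1 - p) := by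
    intro i d
    have h1 := mass_univ d
    have h2 := slice_univ i true d
    rw [mass] at h1
    rw [slice, sum_filter] at h2
    rw [sum_sub_distrib, ← mul_sum, ← mul_sum, h1, h2, mul_one, mul_one]
  rw [sum_congr rfl fun x _ => h2 x, sum_comm]
  rw [sum_congr rfl fun i _ => (sum_comm.trans (sum_congr rfl fun d _ => h3 i d))]
  simp only [sum_const, card_univ, nsmul_eq_mul, Fintype.card_fun, Fintype.card_bool,
    Nat.cast_pow, Nat.cast_ofNat]
  ring

end CubeRectangle

/-! ### Linear lower bound for disjointness -/

namespace Communication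

open CubeRectangle

/-- The randomized communication complexity of a problem to which set disjointness reduces. -/
theorem card_mul_le_cost {I X Y : Type*} [Fintype I] (φ : (I → Bool) → X) (ψ : (I → Bool) → Y)
    (f : X → Y → Bool) (hf : ∀ x y, f (φ x) (ψ y) = true ↔ ∀ i, ¬(x i = true ∧ y i = true))
    {p : ℝ≥0} (hp : 1 / 2 < p) (hp1 : p ≤ 1)
    (hI : 800 ≤ (Fintype.card I : ℝ) * (2 * p - 1) ^ 2)
    (R : RandomizedProtocol X Y Bool) (hR : R.Computes p f) (k : ℕ) (hk : R.cost ≤ k) :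
    (2 * p - 1 : ℝ) ^ 2 / 1600 * Fintype.card I ≤ k := by
  classical
  have hp' : (1 / 2 : ℝ) < p := by exact_mod_cast hp
  have hp1' : (p : ℝ) ≤ 1 := by exact_mod_cast hp1
  set γ : ℝ := 2 * p - 1 with hγ
  set N := (Fintype.card I : ℝ) with hN
  have hγ0 : 0 < γ := by linarith
  have hη : 0 < γ / 4 := by linarith
  -- With `η = γ/4` and `δ = γ²/1600` both parts of `θ` are `γ/4`; `θ = γ/2` keeps at least half of
  -- the advantage `γ`.
  have hθ : γ / 4 + 100 / (γ / 4) * (γ ^ 2 / 1600) = γ / 2 := by field_simp; norm_num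
  have hupper := sum_acceptance_le φ ψ (signedWeight (I := I) (γ / 2))
    (ε := 2 ^ Fintype.card I * (100 / (γ / 4) * Real.exp (-(γ ^ 2 / 1600 * N)))) (by positivity)
    (fun A B => hθ ▸ sum_signedWeight_le hη (by linarith) A B) R k hk
  have hlower := le_sum_signedWeight_mul (I := I) (θ := γ / 2) (p := p) (by linarith)
    (fun x y => acceptance R (φ x) (ψ y))
    (fun x y h => le_acceptance hR ((hf x y).2 h))
    (fun x y i hx hy => acceptance_le hR (by
      rw [← Bool.not_eq_true, hf]
      exact fun h => h i ⟨hx, hy⟩))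
  have h1 := hlower.trans hupper
  rw [mul_left_comm (2 ^ k), mul_le_mul_iff_right₀ (by positivity), Real.exp_neg] at h1
  have h2 : N * (γ / 2) ≤ N * ((1 - γ / 2) * p - (1 - p)) :=
    mul_le_mul_of_nonneg_left (by nlinarith) (by positivity)
  -- The size assumption `hI` serves to cancel the prefactor `400 / γ` of the error.
  have h3 : (400 / γ : ℝ) ≤ N * (γ / 2) := by
    rw [div_le_iff₀ hγ0]; linarith
  have h4 : (400 / γ : ℝ) ≤ 400 / γ * (2 ^ k * (Real.exp (γ ^ 2 / 1600 * N))⁻¹) := by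
    refine (h3.trans (h2.trans h1)).trans (le_of_eq ?_)
    field_simp; norm_num
  have h5 : 1 ≤ 2 ^ k * (Real.exp (γ ^ 2 / 1600 * N))⁻¹ :=
    le_of_mul_le_mul_left (by simpa using h4) (by positivity : 0 < 400 / γ)
  rw [← div_eq_mul_inv, one_le_div (Real.exp_pos _)] at h5
  have h6 : (2 : ℝ) ^ k ≤ Real.exp k := by
    rw [← Real.exp_one_pow]
    exact pow_le_pow_left₀ (by norm_num) (by linarith [Real.add_one_le_exp 1]) k
  exact Real.exp_le_exp.1 (h5.trans h6)

end Communication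

/-! ### Stability and disjointness -/

namespace StableMarriage

open Communication

/-- The preference list that sorts `A` by an injective key. -/
def PrefList.ofKey {A K : Type*} [LinearOrder K] (key : A → K) (h : Function.Injective key) :
    PrefList A where
  prefers a b := key a < key b
  isStrictTotalOrder :=
    { irrefl := fun _ => lt_irrefl _
      trans := fun _ _ _ => lt_trans
      trichotomous := fun _ _ h₁ h₂ => h (le_antisymm (not_lt.1 h₂) (not_lt.1 h₁)) }

-- Sort by rank: `0` on `s`, `1` at `a`, `2` elsewhere, with ties broken by an enumeration.
open Classical in
theorem exists_prefList {A : Type*} [Fintype A] (a : A) (s : A → Bool) :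
    ∃ l : PrefList A, ∀ b, l.prefers b a ↔ b ≠ a ∧ s b = true := by
  refine ⟨PrefList.ofKey (fun b => toLex
    ((if b = a then 1 else if s b = true then 0 else 2 : ℕ), Fintype.equivFin A b)) ?_, ?_⟩
  · intro b c h
    simpa using congrArg (fun z => (ofLex z).2) h
  · intro b
    simp only [PrefList.ofKey, Prod.Lex.toLex_lt_toLex]
    by_cases hb : b = a
    · simp [hb]
    · cases s b <;> simp [hb]

variable {W M : Type*} [Fintype W] [Fintype M]

/-- The pairs that are not married to each other. -/
abbrev OffPair (μ : W ≃ M) := {z : W × M // z.2 ≠ μ z.1}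

theorem exists_disjointness_reduction (μ : W ≃ M) :
    ∃ (φ : (OffPair μ → Bool) → Profile W M) (ψ : (OffPair μ → Bool) → Profile M W),
      ∀ x y, stabilityProblem μ (φ x) (ψ y) = true ↔ ∀ i, ¬(x i = true ∧ y i = true) := by
  classical
  choose φ hφ using fun (x : OffPair μ → Bool) (w : W) =>
    exists_prefList (μ w) fun m => if h : m ≠ μ w then x ⟨(w, m), h⟩ else false
  choose ψ hψ using fun (y : OffPair μ → Bool) (m : M) =>
    exists_prefList (μ.symm m) fun w => if h : m ≠ μ w then y ⟨(w, m), h⟩ else false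
  refine ⟨φ, ψ, fun x y => ?_⟩
  simp only [stabilityProblem, decide_eq_true_eq, IsStable, IsBlockingPair, hφ, hψ]
  constructor
  · rintro h ⟨⟨w, m⟩, hne⟩ ⟨hx, hy⟩
    have hne' : m ≠ μ w := hne
    refine h w m ⟨⟨hne', by simpa [hne'] using hx⟩, ?_, by simpa [hne'] using hy⟩
    exact fun h => hne' (by rw [h, Equiv.apply_symm_apply])
  · rintro h w m ⟨⟨hne, hx⟩, -, hy⟩
    exact h ⟨(w, m), hne⟩ ⟨by simpa [hne] using hx, by simpa [hne] using hy⟩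

open Classical in
theorem card_offPair (μ : W ≃ M) :
    Fintype.card (OffPair μ) + Fintype.card W = Fintype.card W ^ 2 := by
  have h : Fintype.card {z : W × M // z.2 = μ z.1} = Fintype.card W :=
    Fintype.card_congr
      { toFun := fun z => z.1.1
        invFun := fun w => ⟨(w, μ w), rfl⟩
        left_inv := by rintro ⟨⟨w, m⟩, h⟩; simp only at h; subst h; rfl
        right_inv := fun _ => rfl }
  have h2 : Fintype.card (OffPair μ) =
      Fintype.card (W × M) - Fintype.card {z : W × M // z.2 = μ z.1} := by
    convert Fintype.card_subtype_compl fun z : W × M => z.2 = μ z.1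
  have h3 := Fintype.card_subtype_le fun z : W × M => z.2 = μ z.1
  rw [h, Fintype.card_prod, ← Fintype.card_congr μ, ← sq] at h2 h3
  omega

-- Alice's lists matter only through one bit for each pair: whether `w` prefers `m` to her spouse.
-- Bob's answer is the extra bit.
open Classical in
theorem randomizedComplexity_stabilityProblem_le {p : ℝ≥0} (hp1 : p ≤ 1) (μ : W ≃ M) :
    randomizedComplexity p (stabilityProblem μ) ≤ (Fintype.card W ^ 2 : ℕ) + 1 := by
  have hcard : Fintype.card (W × M) = Fintype.card W ^ 2 := by
    rw [Fintype.card_prod, ← Fintype.card_congr μ, sq]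
  let e : W × M ≃ Fin (Fintype.card W ^ 2) := (Fintype.equivFin _).trans (finCongr hcard)
  refine le_trans (le_of_eq ?_) (randomizedComplexity_le (X := Profile W M) (Y := Profile M W) hp1
    (Fintype.card W ^ 2)
    (fun prefW j => decide ((prefW (e.symm j).1).prefers (e.symm j).2 (μ (e.symm j).1)))
    fun z prefM => decide (∀ w m, ¬(z (e (w, m)) = true ∧ (prefM m).prefers w (μ.symm m))))
  congr 1
  ext prefW prefM
  simp [stabilityProblem, IsStable, IsBlockingPair]

theorem le_randomizedComplexity_stabilityProblem {p : ℝ≥0} (hp : 1 / 2 < p) (hp1 : p ≤ 1)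
    (μ : W ≃ M) (hn : 2 ≤ Fintype.card W)
    (hn' : 1600 ≤ (2 * p - 1 : ℝ) ^ 2 * Fintype.card W) :
    (⌈(2 * p - 1 : ℝ) ^ 2 / 3200 * Fintype.card W ^ 2⌉₊ : ℕ∞) ≤
      randomizedComplexity p (stabilityProblem μ) := by
  classical
  refine le_iInf₂ fun R hR => ?_
  induction hcost : R.cost using ENat.recTopCoe with
  | top => exact le_top
  | coe k =>
    rw [Nat.cast_le, Nat.ceil_le]
    obtain ⟨φ, ψ, h⟩ := exists_disjointness_reduction μ
    have hcard : (Fintype.card (OffPair μ) : ℝ) + Fintype.card W = Fintype.card W ^ 2 := by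
      exact_mod_cast card_offPair μ
    have hn2 : (2 : ℝ) ≤ Fintype.card W := by exact_mod_cast hn
    -- `n² - n ≥ n²/2` for `n ≥ 2`; this turns `1600` into `3200`.
    have hhalf : (Fintype.card W : ℝ) ^ 2 / 2 ≤ Fintype.card (OffPair μ) := by nlinarith
    have hγ := sq_nonneg (2 * p - 1 : ℝ)
    have hle : (Fintype.card W : ℝ) / 2 ≤ Fintype.card (OffPair μ) := by nlinarith
    have key := card_mul_le_cost φ ψ (stabilityProblem μ) h hp hp1 (by nlinarith) R hR k hcost.le
    refine le_trans ?_ key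
    have := mul_le_mul_of_nonneg_left hhalf hγ
    linarith

end StableMarriage

theorem corollary5 (p : ℝ≥0) (hp : 1 / 2 < p) (hp1 : p ≤ 1) :
    ∃ (c C : ℝ≥0) (n₀ : ℕ), 0 < c ∧
      ∀ (n : ℕ), n₀ ≤ n →
      ∀ (W M : Type*) [Fintype W] [Fintype M], Fintype.card W = n → Fintype.card M = n →
      ∀ μ : W ≃ M,
        (c : ℝ≥0∞) * (n : ℝ≥0∞) ^ 2 ≤
            (Communication.randomizedComplexity p (StableMarriage.stabilityProblem μ) : ℝ≥0∞) ∧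
        (Communication.randomizedComplexity p (StableMarriage.stabilityProblem μ) : ℝ≥0∞) ≤
            (C : ℝ≥0∞) * (n : ℝ≥0∞) ^ 2 := by
  have hp' : (1 / 2 : ℝ) < p := by exact_mod_cast hp
  have hγ : 0 < (2 * p - 1 : ℝ) ^ 2 := pow_pos (by linarith) 2
  obtain ⟨c, hc⟩ : ∃ c : ℝ≥0, (c : ℝ) = (2 * p - 1 : ℝ) ^ 2 / 3200 :=
    ⟨Real.toNNReal _, Real.coe_toNNReal _ (by positivity)⟩
  -- `C = 2` absorbs Bob's answer bit; the second threshold makes `(2p - 1)² n ≥ 1600`.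
  refine ⟨c, 2,
    max 2 ⌈1600 / (2 * p - 1 : ℝ) ^ 2⌉₊, ?_, ?_⟩
  · rw [← NNReal.coe_pos, hc]
    exact div_pos hγ (by norm_num)
  rintro n hn W M _ _ rfl - μ
  have h2 : 2 ≤ Fintype.card W := (le_max_left _ _).trans hn
  have hn' : 1600 ≤ (2 * p - 1 : ℝ) ^ 2 * Fintype.card W := by
    have := Nat.ceil_le.1 ((le_max_right _ _).trans hn)
    rwa [div_le_iff₀' hγ] at this
  constructor
  · have h := ENat.toENNReal_mono
      (StableMarriage.le_randomizedComplexity_stabilityProblem hp hp1 μ h2 hn')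
    refine le_trans ?_ h
    rw [ENat.toENNReal_coe, ← ENNReal.coe_natCast, ← ENNReal.coe_natCast, ← ENNReal.coe_pow,
      ← ENNReal.coe_mul, ENNReal.coe_le_coe, ← NNReal.coe_le_coe]
    push_cast
    rw [hc]
    exact Nat.le_ceil _
  · refine (ENat.toENNReal_mono
      (StableMarriage.randomizedComplexity_stabilityProblem_le hp1 μ)).trans ?_
    have : Fintype.card W ^ 2 + 1 ≤ 2 * Fintype.card W ^ 2 := by nlinarith
    have h : ((Fintype.card W ^ 2 + 1 : ℕ) : ℝ≥0∞) ≤ (2 * Fintype.card W ^ 2 : ℕ) :=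
      Nat.cast_le.2 this
    simpa using h
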